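/- Let $N\ge 2$. Let $cv_N$ be the space of free, minimal, isometric, simplicial actions of the free group $F_N$ on simplicial metric trees up to equivariant isometry, let $CV_N$ be outer space (the same up to equivariant homothety), and let $\overline{CV_N}$ be the closure of $CV_N$ in the space of projectivized translation length functions, whose points are represented by minimal $F_N$-actions on $\mathbb{R}$-trees. A current is an $F_N$-invariant Borel measure on $\partial^2F_N=\partial F_N\times\partial F_N\smallsetminus\Delta$ which is finite on compact sets, and $\langle T,\eta\rangle$ denotes the Kapovich–Lustig intersection form between trees and currents, which satisfies $$\langle T,\eta\rangle=\lim_{k\to\infty}\frac1k\sum_{|v|=k}d_T(p,vp)\,\eta(\mathrm{Cyl}(v))$$ for any base point $p\in T$, where $|v|$ is the word length of $v\in F_N$ in a fixed basis and $\mathrm{Cyl}(v)$ is the set of $(x,y)\in\partial^2F_N$ such that the oriented geodesic from $x$ to $y$ in the Cayley tree passes through $1$ and then through $v$. For $T\in CV_N$ and $T'\in\overline{CV_N}$, let $\mathrm{Lip}(T,T')$ be the infimal Lipschitz constant of an $F_N$-equivariant map $T\to T'$ (for given representatives). For $S,T\in CV_N$, let $d(S,T)=\log\mathrm{Lip}(S,T)$,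 computed with the representatives of covolume $1$, and $d_{sym}(S,T)=d(S,T)+d(T,S)$. A pair $(\eta_-,\eta_+)$ of nonzero currents is positive if $\langle T,\eta_-+\eta_+\rangle>0$ for all $T\in\overline{CV_N}$. For a positive pair and $L\ge 1$, the $L$-axis $A_L([\eta_-],[\eta_+])$ is the set of all $T\in CV_N$ such that $$\sup_{T'\in\overline{CV_N}}\frac{\mathrm{Lip}(T,T')}{\max\left\{\frac{\langle T',\eta_-\rangle}{\langle T,\eta_-\rangle},\frac{\langle T',\eta_+\rangle}{\langle T,\eta_+\rangle}\right\}}\le L.$$ Let $(\eta_-,\eta_+)$ be a positive pair of nonzero currents. For every $T\in CV_N$ there is a unique $\sigma(T)\in\mathbb{R}$ such that $\langle T,\eta_+\rangle=e^{\sigma(T)}\langle T,\eta_-\rangle$, and for all $L_1\ge 1$ and all $S,T\in A_{L_1}([\eta_-],[\eta_+])$, we have $$|\sigma(S)-\sigma(T)|\le d_{sym}(S,T)\le|\sigma(S)-\sigma(T)|+2\log L_1.$$ -/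

import Mathlib

open Filter Topology MeasureTheory
open scoped NNReal ENNReal

namespace OuterSpace

/-! ### Trees with an action of the free group, and outer space -/

/-- An `ℝ`-tree: a nonempty metric space in which any two points are joined by a unique arc, which
is isometric to a segment. -/
class IsRTree (X : Type*) [MetricSpace X] : Prop where
  nonempty : Nonempty X
  exists_geodesic : ∀ x y : X, ∃ γ : ℝ → X, γ 0 = x ∧ γ (dist x y) = y ∧
    ∀ s ∈ Set.Icc 0 (dist x y), ∀ t ∈ Set.Icc 0 (dist x y), dist (γ s) (γ t) = |s - t|
  unique_arc : ∀ f g : C(unitInterval, X), Function.Injective f → Function.Injective g →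
    f 0 = g 0 → f 1 = g 1 → Set.range f = Set.range g

/-- An `F_N`-tree: an `ℝ`-tree with an isometric action of the free group `F_N`. -/
structure FTree (N : ℕ) where
  carrier : Type
  [metric : MetricSpace carrier]
  [action : MulAction (FreeGroup (Fin N)) carrier]
  [isometric : IsIsometricSMul (FreeGroup (Fin N)) carrier]
  [rtree : IsRTree carrier]

instance (N : ℕ) : CoeSort (FTree N) Type := ⟨FTree.carrier⟩

attribute [instance] FTree.metric FTree.action FTree.isometric FTree.rtree

instance {N : ℕ} (T : FTree N) : Nonempty T := IsRTree.nonempty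

instance {N : ℕ} (T : FTree N) : MeasurableSpace T := borel T

instance {N : ℕ} (T : FTree N) : BorelSpace T := ⟨rfl⟩

/-- The segment between two points of a tree. -/
def seg {X : Type*} [MetricSpace X] (x y : X) : Set X := {z | dist x z + dist z y = dist x y}

variable {N : ℕ}

/-- `T` is a simplicial metric tree with a simplicial action of `F_N`: there is an invariant set
`V` of vertices, with finitely many vertices on every segment, such that every other point lies in
an open edge (an open subset of `T`) between two vertices. -/
def FTree.IsSimplicial (T : FTree N) : Prop :=
  ∃ V : Set T,
    (∀ g : FreeGroup (Fin N), ∀ v ∈ V, g • v ∈ V) ∧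
    (∀ x y : T, (seg x y ∩ V).Finite) ∧
    ∀ x : T, x ∉ V → ∃ u ∈ V, ∃ v ∈ V, x ∈ seg u v ∧ seg u v ∩ V = {u, v} ∧
      IsOpen (seg u v \ {u, v})

/-- The action on `T` is free. -/
def FTree.IsFree (T : FTree N) : Prop :=
  ∀ (g : FreeGroup (Fin N)) (x : T), g • x = x → g = 1

/-- The action on `T` is minimal: there is no proper invariant subtree (the subtrees of an
`ℝ`-tree are its nonempty connected subsets). -/
def FTree.IsMinimal (T : FTree N) : Prop :=
  ∀ Y : Set T, IsConnected Y → (∀ g : FreeGroup (Fin N), ∀ y ∈ Y, g • y ∈ Y) → Y = Set.univ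

/-- Unprojectivized outer space `cv_N`: the free, minimal, isometric, simplicial actions of `F_N`
on simplicial metric trees. A point of (projectivized) outer space `CV_N` is the homothety class of
an element of `cv N`, and all the notions below depend on that class only, unless specified
otherwise. -/
def cv (N : ℕ) : Set (FTree N) := {T | T.IsSimplicial ∧ T.IsFree ∧ T.IsMinimal}

/-- The translation length function `g ↦ ‖g‖_T`. -/
noncomputable def FTree.length (T : FTree N) (g : FreeGroup (Fin N)) : ℝ :=
  ⨅ x : T, dist x (g • x)

/-- The closure `\overline{cv}_N` of `cv_N`: the minimal `F_N`-trees whose length function is a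
nonzero element of the closure in `ℝ^{F_N}` (with the product topology) of the set of length
functions of the trees in `cv_N`. -/
def cvBar (N : ℕ) : Set (FTree N) :=
  {T | T.IsMinimal ∧ T.length ≠ 0 ∧ T.length ∈ closure (FTree.length '' cv N)}

/-- The infimal Lipschitz constant `Lip(S, T)` of an `F_N`-equivariant map from `S` to `T`
(a scale dependent quantity). -/
noncomputable def Lip (S T : FTree N) : ℝ≥0∞ :=
  ⨅ (K : ℝ≥0) (_ : ∃ f : S → T, LipschitzWith K f ∧
    ∀ (g : FreeGroup (Fin N)) (x : S), f (g • x) = g • f x), (K : ℝ≥0∞)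

/-- The covolume of a tree `T` in `cv_N`, i.e. the total length of the quotient metric graph: the
one-dimensional Hausdorff measure of a measurable fundamental domain. -/
noncomputable def covol (T : FTree N) : ℝ≥0∞ :=
  ⨅ (K : Set T) (_ : MeasurableSet K) (_ : ∀ x : T, ∃ g : FreeGroup (Fin N), g • x ∈ K),
    μH[1] K

/-- The asymmetric Lipschitz metric on outer space: `d(S, T)` is the logarithm of the infimal
Lipschitz constant of an equivariant map from the covolume one representative of `S` (the tree `S`
with its metric divided by `covol S`) to the covolume one representative of `T`. -/
noncomputable def lipDist (S T : FTree N) : ℝ :=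
  Real.log (Lip S T * (covol S / covol T)).toReal

/-- The symmetrized Lipschitz metric. -/
noncomputable def dSym (S T : FTree N) : ℝ := lipDist S T + lipDist T S

/-! ### The boundary of the free group -/

/-- Letters: `(i, true)` is the `i`-th element of the basis of `F_N`, `(i, false)` its inverse. -/
abbrev Letter (N : ℕ) : Type := Fin N × Bool

/-- The inverse of a letter. -/
def Letter.inv (a : Letter N) : Letter N := (a.1, !a.2)

@[simp] lemma Letter.inv_inv (a : Letter N) : a.inv.inv = a := by simp [Letter.inv]

/-- The Gromov boundary of `F_N`: infinite reduced words, as a subspace of the product of the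
discrete spaces of letters. -/
def Boundary (N : ℕ) : Type := {x : ℕ → Letter N // ∀ n, x (n + 1) ≠ (x n).inv}

instance : TopologicalSpace (Boundary N) := instTopologicalSpaceSubtype

namespace Boundary

lemma ext {x y : Boundary N} (h : ∀ n, x.1 n = y.1 n) : x = y := Subtype.ext (funext h)

/-- Deletion of the first letter. -/
def tail (x : Boundary N) : Boundary N := ⟨fun n => x.1 (n + 1), fun n => x.2 (n + 1)⟩

/-- Addition of a first letter which does not cancel. -/
def cons (a : Letter N) (x : Boundary N) (h : x.1 0 ≠ a.inv) : Boundary N :=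
  ⟨fun n => Nat.casesOn n a x.1, fun n => by cases n with
    | zero => exact h
    | succ n => exact x.2 n⟩

/-- Left multiplication by a letter, followed by reduction. -/
def mulLetter (a : Letter N) (x : Boundary N) : Boundary N :=
  if h : x.1 0 = a.inv then x.tail else cons a x h

lemma mulLetter_inv (a : Letter N) (x : Boundary N) : mulLetter a.inv (mulLetter a x) = x := by
  by_cases h : x.1 0 = a.inv
  · have h2 : ¬ (x.tail.1 0 = a.inv.inv) := by
      have := x.2 0
      rw [h] at this
      exact this
    rw [mulLetter, mulLetter, dif_pos h, dif_neg h2]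
    refine Boundary.ext fun n => ?_
    cases n with
    | zero => exact h.symm
    | succ n => rfl
  · have h2 : (cons a x h).1 0 = a.inv.inv := by simp [cons]
    rw [mulLetter, mulLetter, dif_neg h, dif_pos h2]
    rfl

/-- Left multiplication by a letter as a permutation of the boundary. -/
def mulLetterPerm (a : Letter N) : Equiv.Perm (Boundary N) where
  toFun := mulLetter a
  invFun := mulLetter a.inv
  left_inv := mulLetter_inv a
  right_inv x := by simpa using mulLetter_inv a.inv x

/-- The action of `F_N` on its boundary, by left multiplication and reduction. -/
instance : MulAction (FreeGroup (Fin N)) (Boundary N) :=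
  MulAction.compHom (Boundary N)
    (FreeGroup.lift (fun i : Fin N => mulLetterPerm (N := N) (i, true)))

end Boundary

/-- The double boundary `∂²F_N`: ordered pairs of distinct points of the boundary. -/
def DoubleBoundary (N : ℕ) : Type := {q : Boundary N × Boundary N // q.1 ≠ q.2}

instance : TopologicalSpace (DoubleBoundary N) := instTopologicalSpaceSubtype

instance : MeasurableSpace (DoubleBoundary N) := borel _

instance : BorelSpace (DoubleBoundary N) := ⟨rfl⟩

/-- The diagonal action of `F_N` on its double boundary. -/
instance : MulAction (FreeGroup (Fin N)) (DoubleBoundary N) where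
  smul g q := ⟨(g • q.1.1, g • q.1.2), fun h => q.2 (MulAction.injective g h)⟩
  one_smul q := Subtype.ext (Prod.ext (one_smul _ q.1.1) (one_smul _ q.1.2))
  mul_smul g h q := Subtype.ext (Prod.ext (mul_smul g h q.1.1) (mul_smul g h q.1.2))

/-! ### Currents and the intersection form -/

/-- A current on `F_N`: an `F_N`-invariant Borel measure on the double boundary that is finite on
compact subsets. -/
structure Current (N : ℕ) where
  measure : Measure (DoubleBoundary N)
  [invariant : SMulInvariantMeasure (FreeGroup (Fin N)) (DoubleBoundary N) measure]
  [finite_on_compacts : IsFiniteMeasureOnCompacts measure]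

attribute [instance] Current.invariant Current.finite_on_compacts

/-- For a reduced word `w`, the set of all `(x, y)` such that the oriented geodesic from `x` to `y`
in the Cayley tree of `F_N` passes through the vertex `1` and then follows the path labelled `w`.
This set is empty if `w` is not reduced. -/
def cyl (w : List (Letter N)) : Set (DoubleBoundary N) :=
  {q | q.1.1.1 0 ≠ q.1.2.1 0 ∧ ∀ (i : ℕ) (h : i < w.length), q.1.2.1 i = w[i]}

lemma mk_singleton_smul (a : Letter N) (x : Boundary N) :
    (FreeGroup.mk [a] : FreeGroup (Fin N)) • x = Boundary.mulLetter a x := by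
  change FreeGroup.lift (fun i : Fin N => Boundary.mulLetterPerm (N := N) (i, true))
    (FreeGroup.mk [a]) x = _
  rcases a with ⟨i, b⟩
  cases b
  · simp [FreeGroup.lift_mk]
    rfl
  · simp [FreeGroup.lift_mk]
    rfl

lemma continuous_fst_letter (n : ℕ) : Continuous fun q : DoubleBoundary N => q.1.1.1 n := by
  have h1 : Continuous fun q : DoubleBoundary N => q.1 := continuous_induced_dom
  have h2 : Continuous fun x : Boundary N => x.1 := continuous_induced_dom
  exact (continuous_apply n).comp (h2.comp (continuous_fst.comp h1))

lemma continuous_snd_letter (n : ℕ) : Continuous fun q : DoubleBoundary N => q.1.2.1 n := by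
  have h1 : Continuous fun q : DoubleBoundary N => q.1 := continuous_induced_dom
  have h2 : Continuous fun x : Boundary N => x.1 := continuous_induced_dom
  exact (continuous_apply n).comp (h2.comp (continuous_snd.comp h1))

lemma measurableSet_fst_letter (n : ℕ) (s : Set (Letter N)) :
    MeasurableSet {q : DoubleBoundary N | q.1.1.1 n ∈ s} :=
  ((isOpen_discrete s).preimage (continuous_fst_letter n)).measurableSet

lemma measurableSet_snd_letter (n : ℕ) (s : Set (Letter N)) :
    MeasurableSet {q : DoubleBoundary N | q.1.2.1 n ∈ s} :=
  ((isOpen_discrete s).preimage (continuous_snd_letter n)).measurableSet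

lemma measurableSet_ne : MeasurableSet {q : DoubleBoundary N | q.1.1.1 0 ≠ q.1.2.1 0} :=
  ((isOpen_discrete {p : Letter N × Letter N | p.1 ≠ p.2}).preimage
    ((continuous_fst_letter 0).prodMk (continuous_snd_letter 0))).measurableSet

lemma measurableSet_cyl (w : List (Letter N)) : MeasurableSet (cyl w) := by
  have : cyl w = {q : DoubleBoundary N | q.1.1.1 0 ≠ q.1.2.1 0} ∩
      ⋂ (i : ℕ) (h : i < w.length), {q : DoubleBoundary N | q.1.2.1 i ∈ ({w[i]} : Set _)} := by
    ext q; simp [cyl]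
  rw [this]
  exact measurableSet_ne.inter (MeasurableSet.iInter fun i => MeasurableSet.iInter fun h =>
    measurableSet_snd_letter i _)

instance : CompactSpace (Boundary N) := by
  have : IsClosed {x : ℕ → Letter N | ∀ n, x (n + 1) ≠ (x n).inv} := by
    simp only [Set.ofPred_forall]
    refine isClosed_iInter fun n => ?_
    have hc : Continuous fun x : ℕ → Letter N => (x (n + 1), x n) :=
      (continuous_apply _).prodMk (continuous_apply _)
    exact (isClosed_discrete {p : Letter N × Letter N | p.1 ≠ p.2.inv}).preimage hc
  exact isCompact_iff_compactSpace.mp this.isCompact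

lemma isCompact_ne : IsCompact {q : DoubleBoundary N | q.1.1.1 0 ≠ q.1.2.1 0} := by
  have hind : IsInducing fun q : DoubleBoundary N => q.1 := ⟨rfl⟩
  refine hind.isCompact_iff.mpr ?_
  have : (fun q : DoubleBoundary N => q.1) '' {q : DoubleBoundary N | q.1.1.1 0 ≠ q.1.2.1 0} =
      {q : Boundary N × Boundary N | q.1.1 0 ≠ q.2.1 0} := by
    ext q
    constructor
    · rintro ⟨q, hq, rfl⟩
      exact hq
    · intro hq
      exact ⟨⟨q, fun h => hq (by rw [h])⟩, hq, rfl⟩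
  rw [this]
  have h2 : Continuous fun x : Boundary N => x.1 := continuous_induced_dom
  have hc : Continuous fun q : Boundary N × Boundary N => (q.1.1 0, q.2.1 0) :=
    ((continuous_apply 0).comp (h2.comp continuous_fst)).prodMk
    ((continuous_apply 0).comp (h2.comp continuous_snd))
  exact ((isClosed_discrete {p : Letter N × Letter N | p.1 ≠ p.2}).preimage hc).isCompact

lemma measure_cyl_ne_top (η : Current N) (w : List (Letter N)) : η.measure (cyl w) ≠ ∞ :=
  ((measure_mono fun _ hq => hq.1).trans_lt isCompact_ne.measure_lt_top).ne

/-- Right extension of cylinders. -/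
lemma sum_cyl_append (η : Current N) (u : List (Letter N)) :
    ∑ a : Letter N, η.measure.real (cyl (u ++ [a])) = η.measure.real (cyl u) := by
  have hU : cyl u = ⋃ a ∈ (Finset.univ : Finset (Letter N)), cyl (u ++ [a]) := by
    ext q
    simp only [Set.mem_iUnion, Finset.mem_univ, exists_prop, true_and]
    constructor
    · intro h
      refine ⟨q.1.2.1 u.length, h.1, fun i hi => ?_⟩
      by_cases h' : i < u.length
      · rw [List.getElem_append_left h']
        exact h.2 i h'
      · have : i = u.length := by simp at hi; omega
        subst this
        simp
    · rintro ⟨a, h1, h2⟩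
      refine ⟨h1, fun i hi => ?_⟩
      rw [h2 i (by simp; omega), List.getElem_append_left hi]
  rw [hU, measureReal_biUnion_finset (h := fun a _ => measure_cyl_ne_top _ _)]
  · intro a _ b _ hab
    refine Set.disjoint_left.mpr fun q h1 h2 => hab ?_
    have e1 := h1.2 u.length (by simp)
    have e2 := h2.2 u.length (by simp)
    simp at e1 e2
    rw [← e1, e2]
  · exact fun a _ => measurableSet_cyl _

/-- Left extension of cylinders, by invariance of currents. -/
lemma sum_cyl_cons (η : Current N) (u : List (Letter N)) :
    ∑ a : Letter N, η.measure.real (cyl (a :: u)) = η.measure.real (cyl u) := by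
  have hpre : ∀ a : Letter N, cyl (a :: u) =
      (fun q : DoubleBoundary N => (FreeGroup.mk [a.inv] : FreeGroup (Fin N)) • q) ⁻¹'
        (cyl u ∩ {q | q.1.1.1 0 ∈ ({a.inv} : Set _)}) := by
    intro a
    ext q
    obtain ⟨⟨x, y⟩, hxy⟩ := q
    change (x.1 0 ≠ y.1 0 ∧ ∀ (i : ℕ) (h : i < (a :: u).length), y.1 i = (a :: u)[i]) ↔
      ((((FreeGroup.mk [a.inv] : FreeGroup (Fin N)) • x).1 0 ≠
        ((FreeGroup.mk [a.inv] : FreeGroup (Fin N)) • y).1 0 ∧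
        ∀ (i : ℕ) (h : i < u.length), ((FreeGroup.mk [a.inv] : FreeGroup (Fin N)) • y).1 i = u[i]) ∧
        ((FreeGroup.mk [a.inv] : FreeGroup (Fin N)) • x).1 0 = a.inv)
    simp only [mk_singleton_smul, Boundary.mulLetter, Letter.inv_inv]
    by_cases hy : y.1 0 = a
    · have hy' : y.tail.1 0 ≠ a.inv := by
        have := y.2 0
        rw [hy] at this
        exact this
      by_cases hx : x.1 0 = a
      · have hx' : x.tail.1 0 ≠ a.inv := by
          have := x.2 0
          rw [hx] at this
          exact this
        simp [hx, hy, hx']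
      · simp only [hx, hy, dif_pos, dif_neg, not_false_eq_true]
        constructor
        · rintro ⟨-, h⟩
          exact ⟨⟨fun h' => hy' h'.symm, fun i hi => h (i + 1) (by simpa using hi)⟩,
            rfl⟩
        · rintro ⟨⟨-, h⟩, -⟩
          refine ⟨fun h' => hx h', fun i hi => ?_⟩
          cases i with
          | zero => exact hy
          | succ i => exact h i (by simpa using hi)
    · constructor
      · rintro ⟨-, h⟩
        exact absurd (h 0 (by simp)) hy
      · rintro ⟨⟨h1, -⟩, h2⟩
        rw [h2, dif_neg (by simpa using hy)] at h1
        exact absurd rfl h1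
  have hcongr : ∀ a : Letter N, η.measure.real (cyl (a :: u)) =
      η.measure.real (cyl u ∩ {q | q.1.1.1 0 ∈ ({a.inv} : Set _)}) := by
    intro a
    rw [hpre a, Measure.real, Measure.real, measure_preimage_smul_of_nullMeasurableSet]
    exact ((measurableSet_cyl u).inter (measurableSet_fst_letter 0 _)).nullMeasurableSet
  rw [Finset.sum_congr rfl fun a _ => hcongr a, ← measureReal_biUnion_finset
    (h := fun a _ => ne_top_of_le_ne_top (measure_cyl_ne_top η u)
      (measure_mono Set.inter_subset_left))]
  · congr 1
    ext q
    simp only [Set.mem_iUnion, Finset.mem_univ, exists_prop, true_and]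
    constructor
    · rintro ⟨a, h, -⟩
      exact h
    · intro h
      exact ⟨(q.1.1.1 0).inv, h, by simp⟩
  · intro a _ b _ hab
    refine Set.disjoint_left.mpr fun q h1 h2 => hab ?_
    have e : a.inv = b.inv := (h1.2 : _ = _).symm.trans h2.2
    rw [← a.inv_inv, e, b.inv_inv]
  · exact fun a _ => (measurableSet_cyl u).inter (measurableSet_fst_letter 0 _)

lemma sum_cyl_ofFn_append (η : Current N) (k : ℕ) (u : List (Letter N)) :
    ∑ w : Fin k → Letter N, η.measure.real (cyl (List.ofFn w ++ u)) = η.measure.real (cyl u) := by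
  induction k with
  | zero => simp
  | succ k ih =>
    rw [← (Fin.consEquiv fun _ => Letter N).sum_comp, Fintype.sum_prod_type, Finset.sum_comm, ← ih]
    refine Finset.sum_congr rfl fun w _ => ?_
    rw [← sum_cyl_cons]
    simp [Fin.consEquiv, List.ofFn_succ]

lemma sum_cyl_append_ofFn (η : Current N) (k : ℕ) (u : List (Letter N)) :
    ∑ w : Fin k → Letter N, η.measure.real (cyl (u ++ List.ofFn w)) = η.measure.real (cyl u) := by
  induction k generalizing u with
  | zero => simp
  | succ k ih =>
    rw [← (Fin.consEquiv fun _ => Letter N).sum_comp, Fintype.sum_prod_type, ← sum_cyl_append]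
    refine Finset.sum_congr rfl fun a _ => ?_
    rw [← ih]
    simp [Fin.consEquiv, List.ofFn_succ]

/-- The sum of `d_T(p, vp) η(cyl v)` over all elements `v` of `F_N` of word length `k` (the words
that are not reduced contribute zero). -/
noncomputable def wordSum (T : FTree N) (p : T) (η : Current N) (k : ℕ) : ℝ :=
  ∑ w : Fin k → Letter N,
    dist p (FreeGroup.mk (List.ofFn w) • p) * η.measure.real (cyl (List.ofFn w))

/-- The intersection form `⟨T, η⟩` of Kapovich and Lustig, on every `F_N`-tree `T` in the closure of
outer space, by the explicit formula
`⟨T, η⟩ = lim_k (1/k) ∑_{|v| = k} d_T(p, vp) η(cyl v)`, for any base point `p` of `T`; the limit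
exists and does not depend on `p`, see `tendsto_inter`. The formula is linear in `η` and homogeneous
in `T`, and on a rational current `η_g` it gives the translation length `‖g‖_T`: for `g` cyclically
reduced of length `n` and `k = mn`, the words of positive weight are the `m`-th powers of the `n`
cyclic permutations `g_i` of `g`, and `d_T(p, g_i ^ m p) / m` tends to `‖g‖_T`. By bounded
cancellation, `d_T(p, vwp) ≥ d_T(p, vp) + d_T(p, wp) - C` for reduced words `vw`, with `C` locally
uniform in `T`, so that the limit is locally uniform and the form is continuous. -/
noncomputable def inter (T : FTree N) (η : Current N) : ℝ :=
  limUnder atTop fun k : ℕ => wordSum T (Classical.arbitrary T) η k / k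

lemma wordSum_nonneg (T : FTree N) (p : T) (η : Current N) (k : ℕ) : 0 ≤ wordSum T p η k :=
  Finset.sum_nonneg fun _ _ => by positivity

lemma wordSum_subadditive (T : FTree N) (p : T) (η : Current N) :
    Subadditive (wordSum T p η) := by
  intro m n
  have key : wordSum T p η (m + n) ≤ ∑ u : Fin m → Letter N, ∑ v : Fin n → Letter N,
      (dist p (FreeGroup.mk (List.ofFn u) • p) + dist p (FreeGroup.mk (List.ofFn v) • p)) *
        η.measure.real (cyl (List.ofFn u ++ List.ofFn v)) := by
    rw [wordSum, ← (Fin.appendEquiv m n).sum_comp, Fintype.sum_prod_type]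
    refine Finset.sum_le_sum fun u _ => Finset.sum_le_sum fun v _ => ?_
    have e : List.ofFn (Fin.appendEquiv m n (u, v)) = List.ofFn u ++ List.ofFn v :=
      List.ofFn_fin_append u v
    rw [e]
    refine mul_le_mul_of_nonneg_right ?_ measureReal_nonneg
    rw [← FreeGroup.mul_mk, mul_smul]
    refine (dist_triangle _ (FreeGroup.mk (List.ofFn u) • p) _).trans ?_
    rw [dist_smul]
  refine key.trans (le_of_eq ?_)
  simp only [add_mul, Finset.sum_add_distrib]
  congr 1
  · refine Finset.sum_congr rfl fun u _ => ?_
    rw [← Finset.mul_sum, sum_cyl_append_ofFn]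
  · rw [Finset.sum_comm]
    refine Finset.sum_congr rfl fun v _ => ?_
    rw [← Finset.mul_sum, sum_cyl_ofFn_append]

lemma abs_wordSum_sub_le (T : FTree N) (p q : T) (η : Current N) (k : ℕ) :
    |wordSum T p η k - wordSum T q η k| ≤ 2 * dist p q * η.measure.real (cyl []) := by
  have h0 := sum_cyl_append_ofFn η k []
  simp only [List.nil_append] at h0
  rw [wordSum, wordSum, ← Finset.sum_sub_distrib, ← h0, Finset.mul_sum]
  refine (Finset.abs_sum_le_sum_abs _ _).trans (Finset.sum_le_sum fun w _ => ?_)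
  rw [← sub_mul, abs_mul, abs_of_nonneg (measureReal_nonneg (μ := η.measure))]
  refine mul_le_mul_of_nonneg_right ?_ measureReal_nonneg
  have := dist_dist_dist_le p (FreeGroup.mk (List.ofFn w) • p) q (FreeGroup.mk (List.ofFn w) • q)
  rw [dist_smul, Real.dist_eq] at this
  linarith

/-- The limit that defines the intersection form exists and does not depend on the base point. -/
theorem tendsto_inter (T : FTree N) (p : T) (η : Current N) :
    Tendsto (fun k : ℕ => wordSum T p η k / k) atTop (𝓝 (inter T η)) := by
  have h1 : Tendsto (fun k : ℕ => wordSum T (Classical.arbitrary T) η k / k) atTop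
      (𝓝 (inter T η)) := by
    refine tendsto_nhds_limUnder ⟨_, (wordSum_subadditive T _ η).tendsto_lim ⟨0, ?_⟩⟩
    rintro _ ⟨k, rfl⟩
    exact div_nonneg (wordSum_nonneg _ _ _ _) (Nat.cast_nonneg _)
  have h2 : Tendsto (fun k : ℕ => wordSum T p η k / k -
      wordSum T (Classical.arbitrary T) η k / k) atTop (𝓝 0) := by
    refine squeeze_zero_norm (fun k => ?_) (tendsto_const_div_atTop_nhds_zero_nat
      (2 * dist p (Classical.arbitrary T) * η.measure.real (cyl [])))
    rw [← sub_div, Real.norm_eq_abs, abs_div, Nat.abs_cast]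
    exact div_le_div_of_nonneg_right (abs_wordSum_sub_le T p _ η k) (Nat.cast_nonneg _)
  simpa using h2.add h1

/-! ### Positive pairs, axes -/

/-- The pair `(η, η')` is positive: `⟨T, η + η'⟩ = ⟨T, η⟩ + ⟨T, η'⟩ > 0` for all `T` in the closure
of outer space. -/
def IsPositivePair (η η' : Current N) : Prop :=
  ∀ T ∈ cvBar N, 0 < inter T η + inter T η'

/-- `Λ_X(S, T)`, the supremum over `η ∈ X` of the stretch `⟨T, η⟩ / ⟨S, η⟩`. -/
noncomputable def maxStretch (X : Set (Current N)) (S T : FTree N) : ℝ≥0∞ :=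
  ⨆ η ∈ X, ENNReal.ofReal (inter T η) / ENNReal.ofReal (inter S η)

/-- `L_{[η],[η']}(S)`, the supremum over all `T` in the closure of outer space of the ratio
`Lip(S, T) / Λ_{[η],[η']}(S, T)`. -/
noncomputable def axisConst (η η' : Current N) (S : FTree N) : ℝ≥0∞ :=
  ⨆ T ∈ cvBar N, Lip S T / maxStretch {η, η'} S T

/-- The `L`-axis `A_L([η], [η'])` in outer space. -/
def axis (L : ℝ) (η η' : Current N) : Set (FTree N) :=
  {S | S ∈ cv N ∧ axisConst η η' S ≤ ENNReal.ofReal L}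

end OuterSpace

/-!
The proof rests on three facts about trees `S`, `T` in `cv_N` and nonzero currents `η`.

* `⟨T, η⟩ > 0` (`inter_pos`). The weights `η(cyl w)` of the words `w` of length `k` add up to
  `η(cyl [])`, which is positive because the translates of `cyl []` cover the double boundary. So it
  suffices that `d(p, g p)` grows at least linearly in the word length of `g`
  (`exists_mul_norm_sub_le_dist`). By minimality, the translates of the segments from a vertex `p` to
  its images under the basis cover `T`; hence, up to translation, there are finitely many edges, and
  distinct vertices have distance at least some `μ > 0`. A segment of length `ℓ` therefore meets
  at most `ℓ / μ + 1` vertices, and, the action being free, the group elements that move base vertices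
  to consecutive ones differ by one of finitely many elements.
* `⟨T, η⟩ ≤ Lip(S, T) ⟨S, η⟩` (`ofReal_inter_div_le_Lip`), from the formula for the intersection
  form. Conversely, `cv_N` lies in its closure (`cv_subset_cvBar`), so that on an `L`-axis
  `Lip(S, T)` is at most `L` times the larger one of the stretch factors of the two currents
  (`Lip_bounds_of_mem_axis`).
* The covolumes are finite and nonzero, and cancel in the symmetrized metric (`dSym_eq_log_mul`).

With `x = ⟨T, η₋⟩ / ⟨S, η₋⟩` and `y = ⟨T, η₊⟩ / ⟨S, η₊⟩`, the product `Lip(S, T) Lip(T, S)` thus lies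
between `max x y * max x⁻¹ y⁻¹ = exp |σ(S) - σ(T)|` and `L²` times this number.
-/

namespace OuterSpace

/-! ### Segments and arcs -/

section Segments

variable {X : Type*} [MetricSpace X]

lemma left_mem_seg (x y : X) : x ∈ seg x y := by simp [seg]

lemma seg_comm (x y : X) : seg x y = seg y x := by
  ext z
  simp only [seg, Set.mem_ofPred_eq, dist_comm x y, dist_comm z y, dist_comm x z]
  rw [add_comm]

lemma dist_add_dist_of_mem_seg {x y z : X} (h : z ∈ seg x y) :
    dist x z + dist z y = dist x y := h

lemma isClosed_seg (x y : X) : IsClosed (seg x y) :=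
  isClosed_eq (by fun_prop) continuous_const

lemma smul_mem_seg_iff {G : Type*} [Group G] [MulAction G X] [IsIsometricSMul G X] (g : G)
    {x y z : X} : g • z ∈ seg (g • x) (g • y) ↔ z ∈ seg x y := by
  simp [seg, dist_smul]

variable [IsRTree X]

/-- Any two points are joined by a compact connected set inside their segment, the image of a
geodesic. Uniqueness of arcs in the tree is not needed to work with these sets. -/
lemma exists_arc [MeasurableSpace X] [BorelSpace X] (x y : X) :
    ∃ C : Set X, C ⊆ seg x y ∧ x ∈ C ∧ y ∈ C ∧ IsPreconnected C ∧ IsCompact C ∧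
      μH[1] C = ENNReal.ofReal (dist x y) := by
  obtain ⟨γ, h0, h1, hγ⟩ := IsRTree.exists_geodesic x y
  have hD : (0 : ℝ) ≤ dist x y := dist_nonneg
  set I : Set ℝ := Set.Icc 0 (dist x y) with hI
  have h0I : (0 : ℝ) ∈ I := ⟨le_rfl, hD⟩
  have h1I : dist x y ∈ I := ⟨hD, le_rfl⟩
  have hiso : Isometry fun t : I => γ t := Isometry.of_dist_eq fun s t => by
    rw [hγ s s.2 t t.2, Subtype.dist_eq, Real.dist_eq]
  have hcont : ContinuousOn γ I := continuousOn_iff_continuous_domRestrict.mpr hiso.continuous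
  refine ⟨γ '' I, ?_, ⟨0, h0I, h0⟩, ⟨_, h1I, h1⟩, isPreconnected_Icc.image _ hcont,
    isCompact_Icc.image_of_continuousOn hcont, ?_⟩
  · rintro _ ⟨t, ht, rfl⟩
    have e0 := hγ 0 h0I t ht
    have e1 := hγ t ht _ h1I
    rw [h0] at e0
    rw [h1] at e1
    change dist x (γ t) + dist (γ t) y = dist x y
    rw [e0, e1, zero_sub, abs_neg, abs_of_nonneg ht.1, abs_sub_comm,
      abs_of_nonneg (sub_nonneg.mpr ht.2)]
    ring
  · have e : γ '' I = (fun t : I => γ t) '' Set.univ := by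
      rw [Set.image_univ]
      exact Set.image_eq_range _ _
    rw [e, hiso.hausdorffMeasure_image (Or.inl zero_le_one),
      ← (isometry_subtype_coe (s := I)).hausdorffMeasure_image (Or.inl zero_le_one),
      Set.image_univ, Subtype.range_coe, hausdorffMeasure_real, hI, Real.volume_Icc, sub_zero]

lemma infinite_seg {x y : X} (h : x ≠ y) : (seg x y).Infinite := by
  borelize X
  obtain ⟨C, hC, -, -, -, -, hH⟩ := exists_arc x y
  refine fun hfin => h ?_
  have : μH[1] C = 0 := by
    have := Measure.nullSingletonClass_hausdorff X zero_lt_one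
    exact (hfin.subset hC).measure_zero _
  rw [hH, ENNReal.ofReal_eq_zero] at this
  exact dist_le_zero.mp this

/-- A segment that leaves an open edge passes through an endpoint of this edge. -/
lemma mem_seg_or_mem_seg_of_isOpen_edge {u v x y : X} (ho : IsOpen (seg u v \ {u, v}))
    (hx : x ∈ seg u v \ {u, v}) (hy : y ∉ seg u v \ {u, v}) : u ∈ seg x y ∨ v ∈ seg x y := by
  borelize X
  obtain ⟨C, hC, hxC, hyC, hconn, -, -⟩ := exists_arc x y
  by_contra! hcon
  have huC : u ∉ C := fun h => hcon.1 (hC h)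
  have hvC : v ∉ C := fun h => hcon.2 (hC h)
  have hy' : y ∉ seg u v := fun h => hy ⟨h, by
    rintro (rfl | rfl)
    exacts [huC hyC, hvC hyC]⟩
  obtain ⟨z, -, hz1, hz2⟩ := hconn _ _ ho (isClosed_seg u v).isOpen_compl
    (fun z hz => by
      by_cases hzs : z ∈ seg u v
      · refine Or.inl ⟨hzs, ?_⟩
        rintro (rfl | rfl)
        exacts [huC hz, hvC hz]
      · exact Or.inr hzs) ⟨x, hxC, hx⟩ ⟨y, hyC, hy'⟩
  exact hz2 hz1.1

end Segments

/-! ### Minimal actions -/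

/-- If arcs `C i` join `p` to `a_i p` for the elements `a_i` of the basis, then the translates of
these arcs cover a minimal tree: their union is connected and invariant. -/
lemma FTree.IsMinimal.exists_smul_mem {T : FTree N} (hT : T.IsMinimal) (i₀ : Fin N) {p : T}
    {C : Fin N → Set T} (hC : ∀ i, IsPreconnected (C i)) (hp : ∀ i, p ∈ C i)
    (hap : ∀ i, FreeGroup.of i • p ∈ C i) (x : T) :
    ∃ (g : FreeGroup (Fin N)) (i : Fin N), g • x ∈ C i := by
  set Y : Set T := {x | ∃ (g : FreeGroup (Fin N)) (i : Fin N), g • x ∈ C i} with hY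
  have hinv : ∀ (g : FreeGroup (Fin N)) (y : T), y ∈ Y → g • y ∈ Y := by
    rintro g y ⟨h, i, hi⟩
    exact ⟨h * g⁻¹, i, by rwa [mul_smul, inv_smul_smul]⟩
  have himage : ∀ (g : FreeGroup (Fin N)) (t : Set T), t ⊆ Y → (g • ·) '' t ⊆ Y := by
    rintro g t ht _ ⟨y, hy, rfl⟩
    exact hinv g y (ht hy)
  have hpre : ∀ (g : FreeGroup (Fin N)) (t : Set T), IsPreconnected t →
      IsPreconnected ((g • ·) '' t) := fun g t ht =>
    ht.image _ (isometry_smul T g).continuous.continuousOn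
  have hCY : ∀ i, C i ⊆ Y := fun i y hy => ⟨1, i, by rwa [one_smul]⟩
  have horbit : ∀ g : FreeGroup (Fin N),
      ∃ t ⊆ Y, p ∈ t ∧ g • p ∈ t ∧ IsPreconnected t := by
    intro g
    induction g using FreeGroup.induction_on with
    | C1 => exact ⟨C i₀, hCY i₀, hp i₀, by simpa using hp i₀, hC i₀⟩
    | of i => exact ⟨C i, hCY i, hp i, hap i, hC i⟩
    | inv_of i _ =>
      refine ⟨_, himage (FreeGroup.of i)⁻¹ _ (hCY i), ⟨_, hap i, ?_⟩, ⟨_, hp i, rfl⟩,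
        hpre _ _ (hC i)⟩
      exact inv_smul_smul _ _
    | mul g h hg hh =>
      obtain ⟨t, ht, hpt, hgt, htc⟩ := hg
      obtain ⟨s, hs, hps, hhs, hsc⟩ := hh
      refine ⟨t ∪ (g • ·) '' s, Set.union_subset ht (himage g s hs), Or.inl hpt,
        Or.inr ⟨_, hhs, (mul_smul g h p).symm⟩, ?_⟩
      exact htc.union (g • p) hgt ⟨p, hps, rfl⟩ (hpre g s hsc)
  have hconn : IsConnected Y := by
    refine ⟨⟨p, hCY i₀ (hp i₀)⟩, isPreconnected_of_forall p fun y hy => ?_⟩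
    obtain ⟨g, i, hg⟩ := hy
    obtain ⟨t, ht, hpt, hgt, htc⟩ := horbit g⁻¹
    refine ⟨t ∪ (g⁻¹ • ·) '' C i, Set.union_subset ht (himage _ _ (hCY i)), Or.inl hpt,
      Or.inr ⟨_, hg, inv_smul_smul g y⟩, ?_⟩
    exact htc.union (g⁻¹ • p) hgt ⟨p, hp i, rfl⟩ (hpre _ _ (hC i))
  have : x ∈ Y := by rw [hT Y hconn hinv]; trivial
  exact this

/-! ### Vertices of simplicial trees -/

/-- A vertex set of a simplicial `F_N`-tree, as in `FTree.IsSimplicial`. -/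
structure IsVertexSet {T : FTree N} (V : Set T) : Prop where
  smul_mem : ∀ g : FreeGroup (Fin N), ∀ v ∈ V, g • v ∈ V
  finite : ∀ x y : T, (seg x y ∩ V).Finite
  edge : ∀ x : T, x ∉ V → ∃ u ∈ V, ∃ v ∈ V, x ∈ seg u v ∧ seg u v ∩ V = {u, v} ∧
    IsOpen (seg u v \ {u, v})

lemma FTree.IsSimplicial.exists_isVertexSet {T : FTree N} (hT : T.IsSimplicial) :
    ∃ V : Set T, IsVertexSet V :=
  let ⟨V, h1, h2, h3⟩ := hT
  ⟨V, h1, h2, h3⟩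

/-- The vertices on the segments from `p` to its translates by the basis of `F_N`. If `p` is a
vertex of a minimal tree, they represent all orbits of vertices, and all edges are translates of
edges between two of them. -/
def baseVertices {T : FTree N} (V : Set T) (p : T) : Set T :=
  ⋃ i : Fin N, seg p (FreeGroup.of i • p) ∩ V

variable {T : FTree N} {V : Set T} {p : T}

lemma mem_baseVertices {w : T} :
    w ∈ baseVertices V p ↔ ∃ i : Fin N, w ∈ seg p (FreeGroup.of i • p) ∧ w ∈ V := by
  simp [baseVertices]

/-- The edge that contains an interior point of the segment between two vertices lies on this
segment, and its endpoints appear there in one of the two orders. -/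
lemma endpoints_mem_seg_of_isOpen_edge {a b u v x : T} (ha : a ∈ V) (hb : b ∈ V)
    (hx : x ∈ seg a b) (hxu : x ∈ seg u v \ {u, v}) (huv : seg u v ∩ V = {u, v})
    (ho : IsOpen (seg u v \ {u, v})) :
    (u ∈ seg a x ∧ v ∈ seg x b) ∨ (v ∈ seg a x ∧ u ∈ seg x b) := by
  have hnot : ∀ c ∈ V, c ∉ seg u v \ {u, v} := fun c hc h => by
    have : c ∈ seg u v ∩ V := ⟨h.1, hc⟩
    rw [huv] at this
    exact h.2 this
  -- The two halves of the segment meet in `x` only.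
  have hboth : ∀ c : T, c ∈ seg a x → c ∈ seg x b → c = x := fun c h1 h2 => by
    have e1 := dist_add_dist_of_mem_seg h1
    have e2 := dist_add_dist_of_mem_seg h2
    have e3 := dist_add_dist_of_mem_seg hx
    have e4 := dist_triangle a c b
    rw [dist_comm x c] at e2
    exact dist_le_zero.mp (by linarith)
  have hux : u ≠ x := fun h => hxu.2 (Or.inl h.symm)
  have hvx : v ≠ x := fun h => hxu.2 (Or.inr h.symm)
  have h1 := mem_seg_or_mem_seg_of_isOpen_edge ho hxu (hnot a ha)
  have h2 := mem_seg_or_mem_seg_of_isOpen_edge ho hxu (hnot b hb)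
  rw [seg_comm x a] at h1
  rcases h1 with h1 | h1 <;> rcases h2 with h2 | h2
  · exact absurd (hboth u h1 h2) hux
  · exact Or.inl ⟨h1, h2⟩
  · exact Or.inr ⟨h1, h2⟩
  · exact absurd (hboth v h1 h2) hvx

namespace IsVertexSet

lemma nonempty (hV : IsVertexSet V) : V.Nonempty := by
  obtain ⟨x⟩ := (inferInstance : Nonempty T)
  by_cases hx : x ∈ V
  · exact ⟨x, hx⟩
  · obtain ⟨u, hu, -⟩ := hV.edge x hx
    exact ⟨u, hu⟩

lemma finite_baseVertices (hV : IsVertexSet V) : (baseVertices V p).Finite :=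
  Set.finite_iUnion fun _ => hV.finite _ _

/-- Between two distinct vertices there is a translate of an edge between two base vertices. -/
lemma exists_edge_between (hV : IsVertexSet V) (hT : T.IsMinimal) (i₀ : Fin N) (hp : p ∈ V)
    {a b : T} (ha : a ∈ V) (hb : b ∈ V) (hab : a ≠ b) :
    ∃ g : FreeGroup (Fin N), ∃ w ∈ baseVertices V p, ∃ w' ∈ baseVertices V p, w ≠ w' ∧
      dist a b = dist a (g • w) + dist w w' + dist (g • w') b := by
  obtain ⟨x, hx, hxV⟩ : ∃ x ∈ seg a b, x ∉ V := by
    by_contra! h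
    exact infinite_seg hab ((hV.finite a b).subset fun x hx => ⟨hx, h x hx⟩)
  choose C hCs hpC hapC hCc _ _ using fun i : Fin N => exists_arc p (FreeGroup.of i • p)
  obtain ⟨g, i, hgi⟩ := hT.exists_smul_mem i₀ hCc hpC hapC x
  obtain ⟨u, hu, v, hv, hxuv, huv, ho⟩ := hV.edge (g • x)
    fun h => hxV (by simpa using hV.smul_mem g⁻¹ _ h)
  have hxe : g • x ∈ seg u v \ {u, v} := ⟨hxuv, by
    rintro (h | h)
    · exact hxV (by rw [← inv_smul_smul g x, h]; exact hV.smul_mem g⁻¹ _ hu)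
    · exact hxV (by rw [← inv_smul_smul g x, h]; exact hV.smul_mem g⁻¹ _ hv)⟩
  have hsub : ∀ {c d y z : T}, y ∈ seg c d → z ∈ seg c y ∨ z ∈ seg y d → z ∈ seg c d := by
    intro c d y z hy hz
    have e := dist_add_dist_of_mem_seg hy
    have e' := dist_triangle c z d
    change dist c z + dist z d = dist c d
    rcases hz with hz | hz
    · have := dist_add_dist_of_mem_seg hz
      have := dist_triangle z y d
      linarith
    · have := dist_add_dist_of_mem_seg hz
      have := dist_triangle c y z
      linarith
  have hbase : u ∈ baseVertices V p ∧ v ∈ baseVertices V p := by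
    have := endpoints_mem_seg_of_isOpen_edge hp (hV.smul_mem _ _ hp) (hCs i hgi) hxe huv ho
    simp only [mem_baseVertices]
    refine ⟨⟨i, hsub (hCs i hgi) ?_, hu⟩, ⟨i, hsub (hCs i hgi) ?_, hv⟩⟩ <;> tauto
  have hdist : ∀ u' v' : T, g • x ∈ seg u' v' → u' ∈ seg (g • a) (g • x) →
      v' ∈ seg (g • x) (g • b) →
      dist a b = dist a (g⁻¹ • u') + dist u' v' + dist (g⁻¹ • v') b := by
    intro u' v' h1 h2 h3
    have e1 := dist_add_dist_of_mem_seg h1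
    have e2 := dist_add_dist_of_mem_seg h2
    have e3 := dist_add_dist_of_mem_seg h3
    have e4 := dist_add_dist_of_mem_seg hx
    have e5 : dist a (g⁻¹ • u') = dist (g • a) u' := by
      rw [← dist_smul g, smul_inv_smul]
    have e6 : dist (g⁻¹ • v') b = dist v' (g • b) := by
      rw [← dist_smul g, smul_inv_smul]
    rw [dist_smul] at e2 e3
    rw [dist_comm u' (g • x)] at e2
    rw [dist_comm u' (g • x)] at e1
    linarith
  have hne : u ≠ v := by
    rintro rfl
    have : dist u (g • x) + dist (g • x) u = dist u u := hxuv
    rw [dist_self, dist_comm u] at this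
    exact hxe.2 (Or.inl (dist_le_zero.mp (by linarith)))
  rcases endpoints_mem_seg_of_isOpen_edge (hV.smul_mem g _ ha) (hV.smul_mem g _ hb)
    ((smul_mem_seg_iff g).mpr hx) hxe huv ho with h | h
  · exact ⟨g⁻¹, u, hbase.1, v, hbase.2, hne, hdist u v hxuv h.1 h.2⟩
  · exact ⟨g⁻¹, v, hbase.2, u, hbase.1, hne.symm,
      hdist v u (by rwa [seg_comm]) h.1 h.2⟩

/-- Distinct vertices have distance at least `μ`, for some `μ > 0`. -/
lemma exists_pos_le_dist (hV : IsVertexSet V) (hT : T.IsMinimal) (i₀ : Fin N) :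
    ∃ μ : ℝ, 0 < μ ∧ ∀ a ∈ V, ∀ b ∈ V, a ≠ b → μ ≤ dist a b := by
  obtain ⟨p, hp⟩ := hV.nonempty
  have hfin : (baseVertices V p).Finite := hV.finite_baseVertices
  obtain ⟨μ, hμ, hW⟩ : ∃ μ : ℝ, 0 < μ ∧ ∀ w ∈ baseVertices V p, ∀ w' ∈ baseVertices V p,
      w ≠ w' → μ ≤ dist w w' := by
    by_cases hnt : (baseVertices V p).Nontrivial
    · exact ⟨_, (hfin.infsep_pos_iff_nontrivial).mpr hnt,
        fun w hw w' hw' h => Set.infsep_le_dist_of_mem hw hw' h⟩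
    · exact ⟨1, one_pos, fun w hw w' hw' h => absurd ⟨w, hw, w', hw', h⟩ hnt⟩
  refine ⟨μ, hμ, fun a ha b hb hab => ?_⟩
  obtain ⟨g, w, hw, w', hw', hne, hd⟩ := hV.exists_edge_between hT i₀ hp ha hb hab
  have := hW w hw w' hw' hne
  have := dist_nonneg (x := a) (y := g • w)
  have := dist_nonneg (x := g • w') (y := b)
  linarith

end IsVertexSet

/-- The orbit map of a vertex of a tree in `cv_N` satisfies the lower bound of a quasi-isometric
embedding of `F_N` with the word metric. -/
lemma exists_mul_norm_sub_le_dist (hT : T ∈ cv N) (i₀ : Fin N) :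
    ∃ (p : T) (c C : ℝ), 0 < c ∧ ∀ g : FreeGroup (Fin N), c * g.norm - C ≤ dist p (g • p) := by
  obtain ⟨hS, hF, hM⟩ := hT
  obtain ⟨V, hV⟩ := hS.exists_isVertexSet
  obtain ⟨p, hp⟩ := hV.nonempty
  obtain ⟨μ, hμ, hsep⟩ := hV.exists_pos_le_dist hM i₀
  have hfin : (baseVertices V p).Finite := hV.finite_baseVertices
  have hpW : p ∈ baseVertices V p := mem_baseVertices.mpr ⟨i₀, left_mem_seg _ _, hp⟩
  -- By freeness, only finitely many elements map a base vertex to a base vertex.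
  set F : Set (FreeGroup (Fin N)) :=
    {s | ∃ w ∈ baseVertices V p, ∃ w' ∈ baseVertices V p, s • w = w'} with hFdef
  have hFfin : F.Finite := by
    have : F = ⋃ w ∈ baseVertices V p, (fun s : FreeGroup (Fin N) => s • w) ⁻¹'
        baseVertices V p := by
      ext s
      simp [F]
    rw [this]
    refine hfin.biUnion fun w _ => hfin.preimage fun s _ t _ hst => ?_
    have : (t⁻¹ * s) • w = w := by
      rw [mul_smul]
      exact (congrArg (t⁻¹ • ·) hst).trans (inv_smul_smul t w)
    exact (inv_mul_eq_one.mp (hF _ _ this)).symm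
  obtain ⟨B, hB⟩ := (hFfin.image FreeGroup.norm).bddAbove
  set M : ℝ := B + 1
  have hM0 : 0 < M := by positivity
  have hFM : ∀ s ∈ F, (s.norm : ℝ) ≤ M := fun s hs => by
    have : s.norm ≤ B := hB ⟨s, hs, rfl⟩
    have : (s.norm : ℝ) ≤ B := by exact_mod_cast this
    linarith
  -- Removing an edge, of length at least `μ`, from the segment between two vertices leaves two
  -- shorter segments. The factor `2` pays for the constants `1` of both of them.
  have key : ∀ (n : ℕ) (g h : FreeGroup (Fin N)), ∀ w ∈ baseVertices V p,
      ∀ w' ∈ baseVertices V p, dist (g • w) (h • w') < n * μ →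
      ((g⁻¹ * h).norm : ℝ) ≤ M * (2 * dist (g • w) (h • w') / μ + 1) := by
    intro n
    induction n with
    | zero =>
      intro g h w _ w' _ hd
      have := dist_nonneg (x := g • w) (y := h • w')
      simp only [Nat.cast_zero, zero_mul] at hd
      linarith
    | succ n ih =>
      intro g h w hw w' hw' hd
      have hgV : g • w ∈ V := hV.smul_mem _ _ (mem_baseVertices.mp hw).choose_spec.2
      have hhV : h • w' ∈ V := hV.smul_mem _ _ (mem_baseVertices.mp hw').choose_spec.2
      by_cases hne : g • w = h • w'
      · rw [hne, dist_self, mul_zero, zero_div, zero_add, mul_one]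
        refine hFM _ ⟨w', hw', w, hw, ?_⟩
        rw [mul_smul, ← hne, inv_smul_smul]
      · obtain ⟨k, u, hu, v, hv, huv, hdist⟩ := hV.exists_edge_between hM i₀ hp hgV hhV hne
        have hle : μ ≤ dist u v := hsep u (mem_baseVertices.mp hu).choose_spec.2 v
          (mem_baseVertices.mp hv).choose_spec.2 huv
        have n1 := dist_nonneg (x := g • w) (y := k • u)
        have n2 := dist_nonneg (x := k • v) (y := h • w')
        push_cast at hd
        have i1 := ih g k w hw u hu (by linarith)
        have i2 := ih k h v hv w' hw' (by linarith)
        have i3 : ((g⁻¹ * h).norm : ℝ) ≤ (g⁻¹ * k).norm + (k⁻¹ * h).norm := by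
          have := FreeGroup.norm_mul_le (g⁻¹ * k) (k⁻¹ * h)
          rw [mul_assoc, mul_inv_cancel_left] at this
          exact_mod_cast this
        have i4 : 2 * dist (g • w) (k • u) / μ + 1 + (2 * dist (k • v) (h • w') / μ + 1) ≤
            2 * dist (g • w) (h • w') / μ + 1 := by
          rw [hdist]
          have : 2 ≤ 2 * dist u v / μ := by rw [le_div_iff₀ hμ]; linarith
          have e : 2 * (dist (g • w) (k • u) + dist u v + dist (k • v) (h • w')) / μ =
            2 * dist (g • w) (k • u) / μ + 2 * dist u v / μ + 2 * dist (k • v) (h • w') / μ := by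
            ring
          linarith
        have := mul_le_mul_of_nonneg_left i4 hM0.le
        linarith
  refine ⟨p, μ / (2 * M), μ / 2, by positivity, fun g => ?_⟩
  obtain ⟨n, hn⟩ := exists_nat_gt (dist p (g • p) / μ)
  have := key n 1 g p hpW p hpW (by rw [one_smul]; exact (div_lt_iff₀ hμ).mp hn)
  rw [inv_one, one_mul, one_smul] at this
  have h2 := mul_le_mul_of_nonneg_left this (show 0 ≤ μ / (2 * M) by positivity)
  have e : μ / (2 * M) * (M * (2 * dist p (g • p) / μ + 1)) = dist p (g • p) + μ / 2 := by
    field_simp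
  linarith

/-! ### Outer space lies in its closure -/

lemma length_of_pos (hT : T ∈ cv N) (i : Fin N) : 0 < T.length (FreeGroup.of i) := by
  obtain ⟨p, c, C, hc, h⟩ := exists_mul_norm_sub_le_dist hT i
  refine hc.trans_le (le_ciInf fun x => ?_)
  set a := FreeGroup.of i
  have hpow : ∀ n : ℕ, dist x (a ^ n • x) ≤ n * dist x (a • x) := by
    intro n
    induction n with
    | zero => simp
    | succ n ih =>
      have := dist_triangle x (a ^ n • x) (a ^ (n + 1) • x)
      rw [pow_succ, mul_smul, dist_smul] at this
      rw [pow_succ, mul_smul]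
      push_cast
      linarith
  have hlin : ∀ n : ℕ, c * n - (C + 2 * dist p x) ≤ n * dist x (a • x) := by
    intro n
    have h1 := h (a ^ n)
    rw [FreeGroup.norm_of_pow] at h1
    have h2 := dist_triangle4 p x (a ^ n • x) (a ^ n • p)
    rw [dist_smul, dist_comm x p] at h2
    linarith [hpow n]
  by_contra! hlt
  obtain ⟨n, hn⟩ := exists_nat_gt ((C + 2 * dist p x) / (c - dist x (a • x)))
  rw [div_lt_iff₀ (by linarith)] at hn
  linarith [hlin n]

lemma cv_subset_cvBar (i₀ : Fin N) : cv N ⊆ cvBar N := fun T hT =>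
  ⟨hT.2.2, fun h => (length_of_pos hT i₀).ne' (by rw [h]; rfl),
    subset_closure ⟨T, hT, rfl⟩⟩

/-! ### The covolume -/

lemma covol_ne_top (hT : T.IsMinimal) (i₀ : Fin N) : covol T ≠ ∞ := by
  obtain ⟨p⟩ := (inferInstance : Nonempty T)
  choose C _ hpC hapC hCc hCk hCH using fun i : Fin N => exists_arc p (FreeGroup.of i • p)
  refine ne_top_of_le_ne_top ?_ (iInf₂_le_of_le (⋃ i, C i)
    (MeasurableSet.iUnion fun i => (hCk i).isClosed.measurableSet)
    (iInf_le_of_le (fun x => ?_) le_rfl))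
  · refine ne_top_of_le_ne_top ?_ (measure_iUnion_le C)
    simp [hCH, tsum_fintype]
  · obtain ⟨g, i, h⟩ := hT.exists_smul_mem i₀ hCc hpC hapC x
    exact ⟨g, Set.mem_iUnion.mpr ⟨i, h⟩⟩

/-- A small ball around a vertex is disjoint from its translates, so that its length is a lower
bound for the length of every fundamental domain. -/
lemma covol_ne_zero (hT : T ∈ cv N) (i₀ : Fin N) : covol T ≠ 0 := by
  obtain ⟨hS, hF, hM⟩ := hT
  obtain ⟨V, hV⟩ := hS.exists_isVertexSet
  obtain ⟨p, hp⟩ := hV.nonempty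
  obtain ⟨μ, hμ, hsep⟩ := hV.exists_pos_le_dist hM i₀
  set U : Set T := Metric.ball p (μ / 2) with hU
  have hdisj : Pairwise (Function.onFun Disjoint fun g : FreeGroup (Fin N) => (g • ·) ⁻¹' U) := by
    refine fun g h hgh => Set.disjoint_left.mpr fun x hx hx' => ?_
    have h1 : dist (g • x) p < μ / 2 := hx
    have h2 : dist (h • x) p < μ / 2 := hx'
    have hne : p ≠ (g * h⁻¹) • p := fun e => hgh (mul_inv_eq_one.mp (hF _ _ e.symm))
    have h3 := hsep _ hp _ (hV.smul_mem (g * h⁻¹) p hp) hne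
    have h4 : dist (g • x) ((g * h⁻¹) • p) = dist (h • x) p := by
      rw [mul_smul, dist_smul, ← dist_smul h, smul_inv_smul]
    have h5 := dist_triangle p (g • x) ((g * h⁻¹) • p)
    rw [dist_comm p (g • x)] at h5
    linarith
  have hUpos : 0 < μH[1] U := by
    have hne : p ≠ FreeGroup.of i₀ • p := fun e =>
      FreeGroup.of_ne_one i₀ (hF _ _ e.symm)
    obtain ⟨γ, h0, -, hγ⟩ := IsRTree.exists_geodesic p (FreeGroup.of i₀ • p)
    have hd := hsep _ hp _ (hV.smul_mem _ p hp) hne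
    have hmem : μ / 4 ∈ Set.Icc 0 (dist p (FreeGroup.of i₀ • p)) :=
      ⟨by positivity, by linarith⟩
    obtain ⟨C, hCs, -, -, -, -, hCH⟩ := exists_arc p (γ (μ / 4))
    have hpq : dist p (γ (μ / 4)) = μ / 4 := by
      have := hγ 0 ⟨le_rfl, dist_nonneg⟩ _ hmem
      rwa [h0, zero_sub, abs_neg, abs_of_pos (by positivity)] at this
    have hCU : C ⊆ U := fun x hx => by
      have e := dist_add_dist_of_mem_seg (hCs hx)
      have := dist_nonneg (x := x) (y := γ (μ / 4))
      rw [hU, Metric.mem_ball, dist_comm]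
      linarith
    refine lt_of_lt_of_le ?_ (measure_mono hCU)
    rw [hCH, hpq, ENNReal.ofReal_pos]
    positivity
  have hle : ∀ K : Set T, MeasurableSet K →
      (∀ x : T, ∃ g : FreeGroup (Fin N), g • x ∈ K) → μH[1] U ≤ μH[1] K := by
    intro K hK hcov
    have hcount : Countable (FreeGroup (Fin N)) := Quot.mk_surjective.countable
    have hsub : U ⊆ ⋃ g : FreeGroup (Fin N), (U ∩ (g⁻¹ • ·) ⁻¹' K) := fun x hx => by
      obtain ⟨g, hg⟩ := hcov x
      exact Set.mem_iUnion.mpr ⟨g⁻¹, hx, by simpa using hg⟩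
    calc μH[1] U ≤ ∑' g : FreeGroup (Fin N), μH[1] (U ∩ (g⁻¹ • ·) ⁻¹' K) :=
          (measure_mono hsub).trans (measure_iUnion_le _)
      _ = ∑' g : FreeGroup (Fin N), μH[1] ((g • ·) ⁻¹' U ∩ K) := by
          refine tsum_congr fun g => ?_
          rw [← (IsometryEquiv.constSMul g : T ≃ᵢ T).hausdorffMeasure_preimage]
          congr 1
          ext x
          simp
      _ = μH[1] (⋃ g : FreeGroup (Fin N), ((g • ·) ⁻¹' U ∩ K)) := by
          refine (measure_iUnion (fun g h hgh => ?_) fun g => ?_).symm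
          · exact (hdisj hgh).mono Set.inter_subset_left Set.inter_subset_left
          · exact ((Metric.isOpen_ball.preimage (isometry_smul T g).continuous).measurableSet).inter
              hK
      _ ≤ μH[1] K := measure_mono (Set.iUnion_subset fun _ => Set.inter_subset_right)
  refine (hUpos.trans_le ?_).ne'
  exact le_iInf fun K => le_iInf fun hK => le_iInf fun hcov => hle K hK hcov

/-! ### Positivity of the intersection form -/

lemma mem_cyl_nil {q : DoubleBoundary N} : q ∈ cyl [] ↔ q.1.1.1 0 ≠ q.1.2.1 0 := by
  simp [cyl]

/-- Every geodesic of the Cayley tree has a translate through the vertex `1`. -/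
lemma exists_smul_mem_cyl_nil (q : DoubleBoundary N) :
    ∃ g : FreeGroup (Fin N), g • q ∈ cyl [] := by
  obtain ⟨n, hn⟩ : ∃ n, q.1.1.1 n ≠ q.1.2.1 n := by
    by_contra! h
    exact q.2 (Boundary.ext h)
  induction n generalizing q with
  | zero => exact ⟨1, by rwa [one_smul, mem_cyl_nil]⟩
  | succ n ih =>
    by_cases h0 : q.1.1.1 0 = q.1.2.1 0
    · set a := q.1.1.1 0 with ha
      have hx : (FreeGroup.mk [a.inv] : FreeGroup (Fin N)) • q.1.1 = q.1.1.tail := by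
        rw [mk_singleton_smul, Boundary.mulLetter, dif_pos (by simp [ha])]
      have hy : (FreeGroup.mk [a.inv] : FreeGroup (Fin N)) • q.1.2 = q.1.2.tail := by
        rw [mk_singleton_smul, Boundary.mulLetter, dif_pos (by simp [h0])]
      obtain ⟨g, hg⟩ := ih ((FreeGroup.mk [a.inv] : FreeGroup (Fin N)) • q) (by
        change ((FreeGroup.mk [a.inv] : FreeGroup (Fin N)) • q.1.1).1 n ≠
          ((FreeGroup.mk [a.inv] : FreeGroup (Fin N)) • q.1.2).1 n
        rw [hx, hy]
        exact hn)
      exact ⟨g * FreeGroup.mk [a.inv], by rwa [mul_smul]⟩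
    · exact ⟨1, by rwa [one_smul, mem_cyl_nil]⟩

lemma measureReal_cyl_nil_pos (η : Current N) (hη : η.measure ≠ 0) :
    0 < η.measure.real (cyl []) := by
  refine (measureReal_nonneg).lt_of_ne' fun h => hη ?_
  have h0 : η.measure (cyl []) = 0 :=
    ((measureReal_eq_zero_iff (measure_cyl_ne_top η [])).mp h)
  have hcount : Countable (FreeGroup (Fin N)) := Quot.mk_surjective.countable
  have hcov : (Set.univ : Set (DoubleBoundary N)) =
      ⋃ g : FreeGroup (Fin N), (g • ·) ⁻¹' cyl [] := by
    refine (Set.eq_univ_of_forall fun q => ?_).symm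
    exact Set.mem_iUnion.mpr (exists_smul_mem_cyl_nil q)
  rw [← Measure.measure_univ_eq_zero, hcov]
  refine measure_iUnion_null fun g => ?_
  rw [measure_preimage_smul_of_nullMeasurableSet (measurableSet_cyl []).nullMeasurableSet, h0]

/-- Words with a nonempty cylinder are reduced. -/
lemma isReduced_of_mem_cyl {w : List (Letter N)} {q : DoubleBoundary N} (hq : q ∈ cyl w) :
    FreeGroup.IsReduced w := by
  refine List.isChain_iff_getElem.mpr fun i hi h => ?_
  rw [← hq.2 i (by omega), ← hq.2 (i + 1) hi] at h ⊢
  by_contra hne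
  refine q.1.2.2 i (Prod.ext h.symm ?_)
  simp only [Letter.inv]
  revert hne
  cases (q.1.2.1 i).2 <;> cases (q.1.2.1 (i + 1)).2 <;> simp

/-- The intersection form is positive on `cv_N` and nonzero currents: the weights in the formula for
`⟨T, η⟩` have a fixed positive sum, and the distances in this formula grow linearly in the word
length. -/
lemma inter_pos {T : FTree N} (hT : T ∈ cv N) (i₀ : Fin N) (η : Current N)
    (hη : η.measure ≠ 0) : 0 < inter T η := by
  obtain ⟨p, c, C, hc, h⟩ := exists_mul_norm_sub_le_dist hT i₀
  set m := η.measure.real (cyl []) with hm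
  have hm0 : 0 < m := measureReal_cyl_nil_pos η hη
  have hsum : ∀ k : ℕ, (c * k - C) * m ≤ wordSum T p η k := by
    intro k
    have h0 := sum_cyl_append_ofFn η k []
    simp only [List.nil_append] at h0
    rw [hm, ← h0, Finset.mul_sum]
    refine Finset.sum_le_sum fun w _ => ?_
    rcases (cyl (List.ofFn w)).eq_empty_or_nonempty with he | ⟨q, hq⟩
    · simp [he]
    · refine mul_le_mul_of_nonneg_right ?_ measureReal_nonneg
      have hn : (FreeGroup.mk (List.ofFn w)).norm = k := by
        rw [FreeGroup.norm, FreeGroup.toWord_mk, (isReduced_of_mem_cyl hq).reduce_eq,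
          List.length_ofFn]
      simpa [hn] using h (FreeGroup.mk (List.ofFn w))
  have hlim : Tendsto (fun k : ℕ => c * m - C * m / k) atTop (𝓝 (c * m)) := by
    simpa using (tendsto_const_div_atTop_nhds_zero_nat (C * m)).const_sub (c * m)
  refine (mul_pos hc hm0).trans_le (le_of_tendsto_of_tendsto hlim (tendsto_inter T p η) ?_)
  filter_upwards [eventually_gt_atTop 0] with k hk
  have hk' : (0 : ℝ) < k := Nat.cast_pos.mpr hk
  rw [le_div_iff₀ hk', sub_mul, div_mul_cancel₀ _ hk'.ne']
  linarith [hsum k]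

/-! ### Stretch factors and Lipschitz constants -/

/-- An equivariant `K`-Lipschitz map stretches every current by at most `K`. -/
lemma inter_le_mul_inter {S T : FTree N} {K : ℝ≥0} {f : S → T} (hf : LipschitzWith K f)
    (hequi : ∀ (g : FreeGroup (Fin N)) (x : S), f (g • x) = g • f x) (η : Current N) :
    inter T η ≤ K * inter S η := by
  obtain ⟨p⟩ := (inferInstance : Nonempty S)
  refine le_of_tendsto_of_tendsto' (tendsto_inter T (f p) η)
    ((tendsto_inter S p η).const_mul (K : ℝ)) fun k => ?_
  rw [← mul_div_assoc]
  refine div_le_div_of_nonneg_right ?_ (Nat.cast_nonneg _)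
  rw [wordSum, wordSum, Finset.mul_sum]
  refine Finset.sum_le_sum fun w _ => ?_
  rw [← mul_assoc, ← hequi]
  exact mul_le_mul_of_nonneg_right (hf.dist_le_mul _ _) measureReal_nonneg

lemma ofReal_inter_div_le_Lip {S T : FTree N} {η : Current N} (hS : 0 < inter S η) :
    ENNReal.ofReal (inter T η / inter S η) ≤ Lip S T := by
  refine le_iInf₂ fun K ⟨f, hf, hequi⟩ => ?_
  rw [← ENNReal.ofReal_coe_nnreal]
  exact ENNReal.ofReal_le_ofReal ((div_le_iff₀ hS).mpr (inter_le_mul_inter hf hequi η))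

lemma maxStretch_pair {η η' : Current N} {S T : FTree N} (h : 0 < inter S η)
    (h' : 0 < inter S η') :
    maxStretch {η, η'} S T =
      ENNReal.ofReal (max (inter T η / inter S η) (inter T η' / inter S η')) := by
  rw [maxStretch, iSup_pair, ENNReal.ofReal_max, ENNReal.ofReal_div_of_pos h,
    ENNReal.ofReal_div_of_pos h']

/-- On an `L`-axis, the Lipschitz constant to a tree in `cv_N` is the larger one of the two stretch
factors, up to a factor of at most `L`. -/
lemma Lip_bounds_of_mem_axis {η η' : Current N} {L : ℝ} (hL : 1 ≤ L) {S T : FTree N}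
    (i₀ : Fin N) (hη : η.measure ≠ 0) (hη' : η'.measure ≠ 0) (hS : S ∈ axis L η η')
    (hT : T ∈ cv N) :
    max (inter T η / inter S η) (inter T η' / inter S η') ≤ (Lip S T).toReal ∧
      (Lip S T).toReal ≤ L * max (inter T η / inter S η) (inter T η' / inter S η') := by
  have hSη := inter_pos hS.1 i₀ η hη
  have hSη' := inter_pos hS.1 i₀ η' hη'
  have hTη := inter_pos hT i₀ η hη
  set m := max (inter T η / inter S η) (inter T η' / inter S η') with hm
  have hm0 : 0 < m := lt_max_of_lt_left (div_pos hTη hSη)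
  have hle : Lip S T ≤ ENNReal.ofReal (L * m) := by
    have h1 : Lip S T / maxStretch {η, η'} S T ≤ ENNReal.ofReal L :=
      (le_iSup₂ (f := fun (T : FTree N) (_ : T ∈ cvBar N) =>
        Lip S T / maxStretch {η, η'} S T) T (cv_subset_cvBar i₀ hT)).trans hS.2
    rwa [maxStretch_pair hSη hSη', ← hm, ENNReal.div_le_iff (ENNReal.ofReal_pos.mpr hm0).ne'
      ENNReal.ofReal_ne_top, ← ENNReal.ofReal_mul (by linarith)] at h1
  have hfin : Lip S T ≠ ∞ := ne_top_of_le_ne_top ENNReal.ofReal_ne_top hle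
  refine ⟨max_le ?_ ?_, ENNReal.toReal_le_of_le_ofReal (by positivity) hle⟩
  · exact (ENNReal.ofReal_le_iff_le_toReal hfin).mp (ofReal_inter_div_le_Lip hSη)
  · exact (ENNReal.ofReal_le_iff_le_toReal hfin).mp (ofReal_inter_div_le_Lip hSη')

/-- The covolumes cancel in the symmetrized metric. -/
lemma dSym_eq_log_mul {S T : FTree N} (hS : S ∈ cv N) (hT : T ∈ cv N) (i₀ : Fin N)
    (hST : 0 < (Lip S T).toReal) (hTS : 0 < (Lip T S).toReal) :
    dSym S T = Real.log ((Lip S T).toReal * (Lip T S).toReal) := by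
  have cS : 0 < (covol S).toReal :=
    ENNReal.toReal_pos (covol_ne_zero hS i₀) (covol_ne_top hS.2.2 i₀)
  have cT : 0 < (covol T).toReal :=
    ENNReal.toReal_pos (covol_ne_zero hT i₀) (covol_ne_top hT.2.2 i₀)
  rw [dSym, lipDist, lipDist, ENNReal.toReal_mul, ENNReal.toReal_mul, ENNReal.toReal_div,
    ENNReal.toReal_div, ← Real.log_mul (by positivity) (by positivity)]
  congr 1
  field_simp

/-- The product of the larger stretch factors in both directions, in logarithmic form. -/
lemma max_div_mul_max_div {x y x' y' s s' : ℝ} (hx : 0 < x) (hx' : 0 < x')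
    (hy : y = Real.exp s * x) (hy' : y' = Real.exp s' * x') :
    max (x' / x) (y' / y) * max (x / x') (y / y') = Real.exp |s - s'| := by
  have e1 : y' / y = Real.exp (s' - s) * (x' / x) := by
    rw [hy, hy', Real.exp_sub]
    field_simp
  have e2 : y / y' = Real.exp (s - s') * (x / x') := by
    rw [hy, hy', Real.exp_sub]
    field_simp
  have p1 : 0 < x' / x := by positivity
  have p2 : 0 < x / x' := by positivity
  have e3 : x' / x * (x / x') = 1 := by field_simp
  rw [e1, e2]
  rcases le_total s s' with h | h
  · rw [max_eq_right (le_mul_of_one_le_left p1.le (Real.one_le_exp (by linarith))),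
      max_eq_left (mul_le_of_le_one_left p2.le (Real.exp_le_one_iff.mpr (by linarith))),
      mul_assoc, e3, mul_one, abs_of_nonpos (by linarith), neg_sub]
  · rw [max_eq_left (mul_le_of_le_one_left p1.le (Real.exp_le_one_iff.mpr (by linarith))),
      max_eq_right (le_mul_of_one_le_left p2.le (Real.one_le_exp (by linarith))),
      mul_left_comm, e3, mul_one, abs_of_nonneg (by linarith)]

end OuterSpace

theorem mainTheorem9 {N : ℕ} (hN : 2 ≤ N) (ηm ηp : OuterSpace.Current N)
    (hm : ηm.measure ≠ 0) (hp : ηp.measure ≠ 0) (hpos : OuterSpace.IsPositivePair ηm ηp) :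
    (∀ T ∈ OuterSpace.cv N,
      ∃! s : ℝ, OuterSpace.inter T ηp = Real.exp s * OuterSpace.inter T ηm) ∧
    ∀ σ : OuterSpace.FTree N → ℝ,
      (∀ T ∈ OuterSpace.cv N,
        OuterSpace.inter T ηp = Real.exp (σ T) * OuterSpace.inter T ηm) →
      ∀ L : ℝ, 1 ≤ L →
        ∀ S ∈ OuterSpace.axis L ηm ηp, ∀ T ∈ OuterSpace.axis L ηm ηp,
          |σ S - σ T| ≤ OuterSpace.dSym S T ∧
            OuterSpace.dSym S T ≤ |σ S - σ T| + 2 * Real.log L := by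
  have i₀ : Fin N := ⟨0, by omega⟩
  refine ⟨fun T hT => ?_, fun σ hσ L hL S hS T hT => ?_⟩
  · have hTm := OuterSpace.inter_pos hT i₀ ηm hm
    have hTp := OuterSpace.inter_pos hT i₀ ηp hp
    refine ⟨Real.log (OuterSpace.inter T ηp / OuterSpace.inter T ηm), ?_, fun s hs => ?_⟩
    · simp only
      rw [Real.exp_log (div_pos hTp hTm), div_mul_cancel₀ _ hTm.ne']
    · simp only at hs
      rw [hs, mul_div_cancel_right₀ _ hTm.ne', Real.log_exp]
  · have hSm := OuterSpace.inter_pos hS.1 i₀ ηm hm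
    have hTm := OuterSpace.inter_pos hT.1 i₀ ηm hm
    obtain ⟨lo, up⟩ := OuterSpace.Lip_bounds_of_mem_axis hL i₀ hm hp hS hT.1
    obtain ⟨lo', up'⟩ := OuterSpace.Lip_bounds_of_mem_axis hL i₀ hm hp hT hS.1
    have hprod := OuterSpace.max_div_mul_max_div hSm hTm (hσ S hS.1) (hσ T hT.1)
    set m := max (OuterSpace.inter T ηm / OuterSpace.inter S ηm)
      (OuterSpace.inter T ηp / OuterSpace.inter S ηp)
    set m' := max (OuterSpace.inter S ηm / OuterSpace.inter T ηm)
      (OuterSpace.inter S ηp / OuterSpace.inter T ηp)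
    have hm0 : 0 < m := lt_max_of_lt_left (div_pos hTm hSm)
    have hm0' : 0 < m' := lt_max_of_lt_left (div_pos hSm hTm)
    have hST : 0 < (OuterSpace.Lip S T).toReal := hm0.trans_le lo
    have hTS : 0 < (OuterSpace.Lip T S).toReal := hm0'.trans_le lo'
    rw [OuterSpace.dSym_eq_log_mul hS.1 hT.1 i₀ hST hTS]
    constructor
    · rw [Real.le_log_iff_exp_le (mul_pos hST hTS), ← hprod]
      exact mul_le_mul lo lo' hm0'.le hST.le
    · have hL0 : 0 < L := by linarith
      rw [Real.log_le_iff_le_exp (mul_pos hST hTS), Real.exp_add, ← hprod, two_mul, Real.exp_add,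
        Real.exp_log hL0]
      calc (OuterSpace.Lip S T).toReal * (OuterSpace.Lip T S).toReal
          ≤ (L * m) * (L * m') := mul_le_mul up up' hTS.le (by positivity)
        _ = m * m' * (L * L) := by ring
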